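/- Let $\varphi:\mathbb{R}^n\to\mathcal{F}$ be a feature map into a real inner product space, let $k(x,y)=\langle\varphi(x),\varphi(y)\rangle_{\mathcal F}$ be its kernel, and for $X=(x_1,\dots,x_s)\in\mathbb{R}^{n\times s}$ let $K(X)=K(X,X)\in\mathbb{R}^{s\times s}$ be the kernel matrix, $K(X)_{ij}=k(x_i,x_j)$. Let $\mathcal{A}:\mathbb{R}^{n\times s}\to\mathbb{R}^m$ be linear, $b\in\mathbb{R}^m$, and $\mathcal{L}_{\mathcal{A},b}=\{X\in\mathbb{R}^{n\times s}:\mathcal{A}(X)=b\}$, an affine manifold with tangent space $\mathrm{null}(\mathcal{A})$. Let $\mathrm{Grass}(s,r)$ be the Grassmann manifold of $r$-dimensional subspaces of $\mathbb{R}^s$; if $W\in\mathbb{R}^{s\times r}$ has orthonormal columns spanning $\mathcal{W}$, tangent vectors at $\mathcal{W}$ are represented by the matrices $H\in\mathbb{R}^{s\times r}$ with $W^\top H=0$. Both manifolds carry the metric $\langle A,B\rangle=\mathrm{trace}(A^\top B)$, and $\|\cdot\|_F$ denotes the Frobenius norm. On $\mathcal{M}=\mathcal{L}_{\mathcal{A},b}\times\mathrm{Grass}(s,r)$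 consider the cost $$f(X,\mathcal{W})=\mathrm{trace}\big(P_{\mathcal{W}^\perp}K(X,X)\big),$$ where $P_{\mathcal{W}^\perp}$ is the orthogonal projection onto $\mathcal{W}^\perp$, and let $\mathrm{Retr}$ be the exponential map of $\mathcal{M}$, that is, $\mathrm{Retr}_{(X,\mathcal{W})}(\eta_x,\eta_u)=(X+\eta_x,\mathrm{Exp}_{\mathcal{W}}(\eta_u))$. (1) Suppose that $X\mapsto K(X,X)$ is differentiable at every point of $\mathcal{L}_{\mathcal{A},b}$ and that its derivative $\mathrm{D}K$ is Lipschitz continuous on $\mathcal{L}_{\mathcal{A},b}$ with constant $L$ in the Frobenius norm, $\|\mathrm{D}K(X_1)-\mathrm{D}K(X_2)\|_F\le L\|X_1-X_2\|_F$ for all $X_1,X_2\in\mathcal{L}_{\mathcal{A},b}$, where the Frobenius norm of a linear map $\mathbb{R}^{n\times s}\to\mathbb{R}^{s\times s}$ is the square root of the sum of the squares of its matrix entries. Then for all $(X,\mathcal{W})\in\mathcal{M}$ and all $\eta_x\in\mathrm{null}(\mathcal{A})$, the Riemannian gradient $\mathrm{grad}_Xf(X,\mathcal{W})$ exists and $$\Big|f\big(\mathrm{Retr}_{(X,\mathcal{W})}(\eta_x,0)\big)-\big[f(X,\mathcal{W})+\langle\mathrm{grad}_Xf(X,\mathcal{W}),\eta_x\rangle\big]\Big|\le\frac{L_x}{2}\|\eta_x\|_F^2$$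 with $L_x=L$. If instead $\mathrm{D}K$ is Lipschitz continuous on $\mathcal{L}_{\mathcal{A},b}$ with constant $L$ in the operator norm induced by the Frobenius norms, the same holds with $L_x=\sqrt{s-r}\,L$. (2) If $\|K(X,X)\|_F\le M$ for all $X\in\mathcal{L}_{\mathcal{A},b}$, then for all $(X,\mathcal{W})\in\mathcal{M}$ and all $\eta_u\in\mathrm{T}_{\mathcal{W}}\mathrm{Grass}(s,r)$, the Riemannian gradient $\mathrm{grad}_{\mathcal{W}}f(X,\mathcal{W})$ exists and $$\Big|f\big(\mathrm{Retr}_{(X,\mathcal{W})}(0,\eta_u)\big)-\big[f(X,\mathcal{W})+\langle\mathrm{grad}_{\mathcal{W}}f(X,\mathcal{W}),\eta_u\rangle\big]\Big|\le\frac{L_u}{2}\|\eta_u\|_F^2,\qquad L_u=2M.$$ -/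

import Mathlib

open scoped Matrix
open scoped Matrix.Norms.Frobenius

/-! Throughout, `Matrix (Fin p) (Fin q) ℝ` carries the Frobenius norm. -/

namespace KernelRecovery

/-- The inner product `trace (Aᵀ B)` of two real matrices. -/
def frobInner {p q : ℕ} (A B : Matrix (Fin p) (Fin q) ℝ) : ℝ := (Aᵀ * B).trace

/-- The kernel matrix `K(X, X)`, with entries `k(xᵢ, xⱼ) = ⟨φ(xᵢ), φ(xⱼ)⟩`, where `xᵢ` is the
`i`-th column of `X` and `φ` is the feature map. -/
noncomputable def kernelMatrix {F : Type*} [NormedAddCommGroup F] [InnerProductSpace ℝ F]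
    {n s : ℕ} (φ : (Fin n → ℝ) → F) (X : Matrix (Fin n) (Fin s) ℝ) :
    Matrix (Fin s) (Fin s) ℝ :=
  Matrix.of fun i j => inner ℝ (φ (Xᵀ i)) (φ (Xᵀ j))

/-- The affine space `{X : 𝒜(X) = b}` of matrices that fit the measurements. -/
def measurementSpace {n s m : ℕ} (𝒜 : Matrix (Fin n) (Fin s) ℝ →ₗ[ℝ] (Fin m → ℝ))
    (b : Fin m → ℝ) : Set (Matrix (Fin n) (Fin s) ℝ) :=
  {X | 𝒜 X = b}

/-- The matrix of the orthogonal projection onto a subspace of `ℝˢ`. -/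
noncomputable def projMatrix {s : ℕ} (𝒲 : Submodule ℝ (EuclideanSpace ℝ (Fin s))) :
    Matrix (Fin s) (Fin s) ℝ :=
  (Matrix.toEuclideanCLM (𝕜 := ℝ) (n := Fin s)).symm 𝒲.starProjection

/-- The cost `f(X, 𝒲) = trace (P_{𝒲⊥} K(X, X))`. -/
noncomputable def kernelCost {F : Type*} [NormedAddCommGroup F] [InnerProductSpace ℝ F]
    {n s : ℕ} (φ : (Fin n → ℝ) → F) (X : Matrix (Fin n) (Fin s) ℝ)
    (𝒲 : Submodule ℝ (EuclideanSpace ℝ (Fin s))) : ℝ :=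
  (projMatrix 𝒲ᗮ * kernelMatrix φ X).trace

/-- The Stiefel manifold of `s × r` matrices with orthonormal columns. -/
def stiefel (s r : ℕ) : Set (Matrix (Fin s) (Fin r) ℝ) := {W | Wᵀ * W = 1}

/-- The Grassmann manifold, as the set of `r`-dimensional subspaces of `ℝˢ`. -/
def grass (s r : ℕ) : Set (Submodule ℝ (EuclideanSpace ℝ (Fin s))) :=
  {𝒲 | Module.finrank ℝ 𝒲 = r}

/-- The column space of an `s × r` matrix, as a subspace of `ℝˢ`. -/
noncomputable def colSpace {s r : ℕ} (W : Matrix (Fin s) (Fin r) ℝ) :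
    Submodule ℝ (EuclideanSpace ℝ (Fin s)) :=
  LinearMap.range (Matrix.toEuclideanLin W)

/-- The tangent space of the Grassmann manifold at the column space of `W`, in the representation
given by `W` (horizontal lift): all `H` with `Wᵀ H = 0`. -/
def horizontal {s r : ℕ} (W : Matrix (Fin s) (Fin r) ℝ) :
    Submodule ℝ (Matrix (Fin s) (Fin r) ℝ) where
  carrier := {H | Wᵀ * H = 0}
  add_mem' {A B} hA hB := by
    simp only [Set.mem_ofPred_eq] at *
    rw [Matrix.mul_add, hA, hB, add_zero]
  zero_mem' := by simp
  smul_mem' c A hA := by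
    simp only [Set.mem_ofPred_eq] at *
    rw [Matrix.mul_smul, hA, smul_zero]

/-- Horizontal lift to the Stiefel manifold of a geodesic of the Grassmann manifold
`St(s, r) / O(r)`: a horizontal curve on the Stiefel manifold whose acceleration is
orthogonal to the tangent space `{Z : Wᵀ Z + Zᵀ W = 0}` of the Stiefel manifold. -/
def IsHorizontalGeodesic {s r : ℕ} (γ : ℝ → Matrix (Fin s) (Fin r) ℝ) : Prop :=
  ∃ γ₁ γ₂ : ℝ → Matrix (Fin s) (Fin r) ℝ,
    (∀ t, HasDerivAt γ (γ₁ t) t) ∧ (∀ t, HasDerivAt γ₁ (γ₂ t) t) ∧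
    (∀ t, γ t ∈ stiefel s r) ∧ (∀ t, γ₁ t ∈ horizontal (γ t)) ∧
    ∀ t, ∀ Z : Matrix (Fin s) (Fin r) ℝ, (γ t)ᵀ * Z + Zᵀ * γ t = 0 → frobInner (γ₂ t) Z = 0

/-- The geodesic through `W` with velocity `H`, in closed form. -/
noncomputable def grassGeodesic {s r : ℕ} (W H : Matrix (Fin s) (Fin r) ℝ) (t : ℝ) :
    Matrix (Fin s) (Fin r) ℝ :=
  NormedSpace.exp (t • (H * Wᵀ - W * Hᵀ)) * W

/-- The exponential map of the Grassmann manifold at the column space of `W`, applied to the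
tangent vector represented by `H`: the point at time `1` of the geodesic. -/
noncomputable def grassExp {s r : ℕ} (W H : Matrix (Fin s) (Fin r) ℝ) :
    Submodule ℝ (EuclideanSpace ℝ (Fin s)) :=
  colSpace (grassGeodesic W H 1)

/-- The exponential map of the product manifold at the point `(X, colSpace W)`. -/
noncomputable def expRetr {n s r : ℕ} (X : Matrix (Fin n) (Fin s) ℝ)
    (W : Matrix (Fin s) (Fin r) ℝ) (ηx : Matrix (Fin n) (Fin s) ℝ)
    (ηu : Matrix (Fin s) (Fin r) ℝ) :
    Matrix (Fin n) (Fin s) ℝ × Submodule ℝ (EuclideanSpace ℝ (Fin s)) :=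
  (X + ηx, grassExp W ηu)

/-- `G` is the Riemannian gradient at `x`, with respect to the tangent space `T`, of the function
whose extension to the ambient matrix space is `g`: it is the tangent vector that represents the
differential of `g` on `T`, that is, the orthogonal projection onto `T` of the Euclidean
gradient. -/
def IsRiemannianGradient {p q : ℕ} (g : Matrix (Fin p) (Fin q) ℝ → ℝ)
    (x : Matrix (Fin p) (Fin q) ℝ) (T : Submodule ℝ (Matrix (Fin p) (Fin q) ℝ))
    (G : Matrix (Fin p) (Fin q) ℝ) : Prop :=
  G ∈ T ∧ DifferentiableAt ℝ g x ∧ ∀ Z ∈ T, fderiv ℝ g x Z = frobInner G Z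

/-- At every point of the product manifold, the function `f(·, 𝒲)` has a Riemannian gradient, and
`|f(Retr(ηx, 0)) - (f(X, 𝒲) + ⟨grad_X f(X, 𝒲), ηx⟩)| ≤ (Lx / 2) ‖ηx‖²` for all tangent `ηx`. -/
def PullbackLipschitzX {n s m : ℕ} (r : ℕ)
    (f : Matrix (Fin n) (Fin s) ℝ → Submodule ℝ (EuclideanSpace ℝ (Fin s)) → ℝ)
    (𝒜 : Matrix (Fin n) (Fin s) ℝ →ₗ[ℝ] (Fin m → ℝ)) (b : Fin m → ℝ) (Lx : ℝ) : Prop :=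
  ∀ X ∈ measurementSpace 𝒜 b, ∀ W ∈ stiefel s r,
    ∃ G, IsRiemannianGradient (fun Y => f Y (colSpace W)) X (LinearMap.ker 𝒜) G ∧
      ∀ ηx ∈ LinearMap.ker 𝒜,
        |Function.uncurry f (expRetr X W ηx 0) - (f X (colSpace W) + frobInner G ηx)|
          ≤ Lx / 2 * ‖ηx‖ ^ 2

/-- At every point of the product manifold, the function `f(X, ·)` has a Riemannian gradient, and
`|f(Retr(0, ηu)) - (f(X, 𝒲) + ⟨grad_𝒲 f(X, 𝒲), ηu⟩)| ≤ (Lu / 2) ‖ηu‖²` for all tangent `ηu`. -/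
def PullbackLipschitzU {n s m : ℕ} (r : ℕ)
    (f : Matrix (Fin n) (Fin s) ℝ → Submodule ℝ (EuclideanSpace ℝ (Fin s)) → ℝ)
    (𝒜 : Matrix (Fin n) (Fin s) ℝ →ₗ[ℝ] (Fin m → ℝ)) (b : Fin m → ℝ) (Lu : ℝ) : Prop :=
  ∀ X ∈ measurementSpace 𝒜 b, ∀ W ∈ stiefel s r,
    ∃ G, IsRiemannianGradient (fun V => f X (colSpace V)) W (horizontal W) G ∧
      ∀ ηu ∈ horizontal W,
        |Function.uncurry f (expRetr X W 0 ηu) - (f X (colSpace W) + frobInner G ηu)|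
          ≤ Lu / 2 * ‖ηu‖ ^ 2

/-- The derivative `DK(X)` of `X ↦ K(X, X)` at `X`, a linear map on `ℝⁿˣˢ`. -/
noncomputable def kernelDeriv {F : Type*} [NormedAddCommGroup F] [InnerProductSpace ℝ F]
    {n s : ℕ} (φ : (Fin n → ℝ) → F) (X : Matrix (Fin n) (Fin s) ℝ) :
    Matrix (Fin n) (Fin s) ℝ →ₗ[ℝ] Matrix (Fin s) (Fin s) ℝ :=
  (fderiv ℝ (kernelMatrix φ) X).toLinearMap

/-- The Frobenius (Hilbert-Schmidt) norm of a linear map between spaces of matrices: the square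
root of the sum of the squares of all entries of its matrix (for a derivative: of the Jacobian). -/
noncomputable def jacobianFrobNorm {n s : ℕ}
    (D : Matrix (Fin n) (Fin s) ℝ →ₗ[ℝ] Matrix (Fin s) (Fin s) ℝ) : ℝ :=
  Real.sqrt (∑ a, ∑ i, ‖D (Matrix.single a i 1)‖ ^ 2)

/-! The objects above are what their names say: orthonormal matrices represent exactly the points
of the Grassmann manifold, and `grassGeodesic W H` is the geodesic with initial velocity `H`. -/

theorem colSpace_mem_grass {s r : ℕ} {W : Matrix (Fin s) (Fin r) ℝ} (hW : W ∈ stiefel s r) :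
    colSpace W ∈ grass s r := by
  have hinj : Function.Injective (Matrix.toEuclideanLin W) := by
    intro x y hxy
    have h : W *ᵥ x.ofLp = W *ᵥ y.ofLp := by
      simpa [Matrix.toLpLin_apply] using hxy
    have h2 := congrArg (fun v => Wᵀ *ᵥ v) h
    simp only [Matrix.mulVec_mulVec] at h2
    rw [show Wᵀ * W = 1 from hW] at h2
    simp only [Matrix.one_mulVec] at h2
    exact WithLp.ofLp_injective 2 h2
  simp only [grass, colSpace, Set.mem_ofPred_eq]
  rw [LinearMap.finrank_range_of_inj hinj]
  simp

theorem exists_stiefel_of_mem_grass {s r : ℕ}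
    {𝒲 : Submodule ℝ (EuclideanSpace ℝ (Fin s))} (h : 𝒲 ∈ grass s r) :
    ∃ W ∈ stiefel s r, colSpace W = 𝒲 := by
  have h' : Module.finrank ℝ 𝒲 = r := h
  let e := (stdOrthonormalBasis ℝ 𝒲).reindex (finCongr h')
  let W : Matrix (Fin s) (Fin r) ℝ := Matrix.of fun i j => (e j : EuclideanSpace ℝ (Fin s)) i
  have hW : W ∈ stiefel s r := by
    change Wᵀ * W = 1
    ext i j
    have h1 := orthonormal_iff_ite.mp e.orthonormal j i
    rw [Submodule.coe_inner, PiLp.inner_apply] at h1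
    simp only [Matrix.mul_apply, Matrix.transpose_apply, Matrix.one_apply]
    simpa [W, eq_comm] using h1
  refine ⟨W, hW, ?_⟩
  refine Submodule.eq_of_le_of_finrank_eq ?_ ((colSpace_mem_grass hW).trans h'.symm)
  rintro _ ⟨x, rfl⟩
  have : Matrix.toEuclideanLin W x = ∑ j, x j • (e j : EuclideanSpace ℝ (Fin s)) := by
    ext i
    simp [Matrix.toLpLin_apply, Matrix.mulVec, dotProduct, W, mul_comm]
  rw [this]
  exact Submodule.sum_mem _ fun j _ => Submodule.smul_mem _ _ (e j).2

theorem isHorizontalGeodesic_grassGeodesic {s r : ℕ} {W H : Matrix (Fin s) (Fin r) ℝ}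
    (hW : W ∈ stiefel s r) (hH : H ∈ horizontal W) :
    IsHorizontalGeodesic (grassGeodesic W H) ∧ grassGeodesic W H 0 = W ∧
      HasDerivAt (grassGeodesic W H) H 0 := by
  have hW' : Wᵀ * W = 1 := hW
  have hH' : Wᵀ * H = 0 := hH
  have hHW : Hᵀ * W = 0 := by
    have := congrArg Matrix.transpose hH'
    simpa [Matrix.transpose_mul] using this
  obtain ⟨Ω, hΩ⟩ : ∃ Ω : Matrix (Fin s) (Fin s) ℝ, Ω = H * Wᵀ - W * Hᵀ := ⟨_, rfl⟩
  have hγ : grassGeodesic W H = fun t => NormedSpace.exp (t • Ω) * W := by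
    subst hΩ; rfl
  have hΩW : Ω * W = H := by
    rw [hΩ, Matrix.sub_mul, Matrix.mul_assoc, Matrix.mul_assoc, hW', hHW]; simp
  have hΩH : Ω * H = -(W * (Hᵀ * H)) := by
    rw [hΩ, Matrix.sub_mul, Matrix.mul_assoc, Matrix.mul_assoc, hH']; simp
  have hskew : Ωᵀ = -Ω := by
    rw [hΩ]; simp [Matrix.transpose_sub, Matrix.transpose_mul]
  have hexp : ∀ t : ℝ, (NormedSpace.exp (t • Ω))ᵀ * NormedSpace.exp (t • Ω) = 1 := by
    intro t
    rw [← Matrix.exp_transpose, Matrix.transpose_smul, hskew, smul_neg,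
      ← Matrix.exp_add_of_commute _ _ (Commute.refl (t • Ω)).neg_left, neg_add_cancel,
      NormedSpace.exp_zero]
  have hd : ∀ (V : Matrix (Fin s) (Fin r) ℝ) (t : ℝ),
      HasDerivAt (fun t : ℝ => NormedSpace.exp (t • Ω) * V)
        (NormedSpace.exp (t • Ω) * (Ω * V)) t := by
    intro V t
    let R : Matrix (Fin s) (Fin s) ℝ →ₗ[ℝ] Matrix (Fin s) (Fin r) ℝ :=
      { toFun := fun A => A * V
        map_add' := fun A B => Matrix.add_mul A B V
        map_smul' := fun c A => Matrix.smul_mul c A V }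
    have h1 := (LinearMap.toContinuousLinearMap R).hasFDerivAt.comp_hasDerivAt t
      (hasDerivAt_exp_smul_const Ω t)
    rw [← Matrix.mul_assoc]
    exact h1
  have hd0 := hd W
  rw [hΩW] at hd0
  refine ⟨⟨fun t => NormedSpace.exp (t • Ω) * H, fun t => NormedSpace.exp (t • Ω) * (Ω * H),
    fun t => hγ ▸ hd0 t, hd H, fun t => ?_, fun t => ?_, fun t Z hZ => ?_⟩, ?_, ?_⟩
  · change (grassGeodesic W H t)ᵀ * grassGeodesic W H t = 1
    rw [hγ]
    simp only [Matrix.transpose_mul]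
    rw [Matrix.mul_assoc, ← Matrix.mul_assoc _ _ W, hexp, Matrix.one_mul, hW']
  · change (grassGeodesic W H t)ᵀ * (NormedSpace.exp (t • Ω) * H) = 0
    rw [hγ]
    simp only [Matrix.transpose_mul]
    rw [Matrix.mul_assoc, ← Matrix.mul_assoc _ _ H, hexp, Matrix.one_mul, hH']
  · have h2 : NormedSpace.exp (t • Ω) * (Ω * H) = -(grassGeodesic W H t * (Hᵀ * H)) := by
      rw [hΩH, hγ, Matrix.mul_neg, Matrix.mul_assoc]
    change ((NormedSpace.exp (t • Ω) * (Ω * H))ᵀ * Z).trace = 0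
    rw [h2]
    generalize grassGeodesic W H t = U at hZ
    have e1 : ((Hᵀ * H) * (Zᵀ * U)).trace = ((Hᵀ * H) * (Uᵀ * Z)).trace := by
      rw [← Matrix.trace_transpose, Matrix.transpose_mul, Matrix.trace_mul_comm]
      simp [Matrix.transpose_mul]
    have e2 : ((Hᵀ * H) * (Uᵀ * Z + Zᵀ * U)).trace = 0 := by rw [hZ]; simp
    rw [Matrix.mul_add, Matrix.trace_add, e1] at e2
    have e3 : ((-(U * (Hᵀ * H)))ᵀ * Z).trace = -((Hᵀ * H) * (Uᵀ * Z)).trace := by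
      simp [Matrix.transpose_mul, Matrix.mul_assoc]
    rw [e3]
    linarith
  · rw [hγ]; simp
  · have h0 := hd0 0
    rw [zero_smul, NormedSpace.exp_zero, Matrix.one_mul] at h0
    rw [hγ]
    exact h0

end KernelRecovery

/-! The cost is `⟪P_{𝒲⊥}, K(X)⟫` for the inner product `trace (Aᵀ B)`.

In the direction of `X` it is a fixed linear functional of `K(X)`, so Taylor's formula along a
segment reduces the claim to a Lipschitz bound for `Z ↦ ⟪P_{𝒲⊥}, DK(X) Z⟫`. For the operator norm,
the Cauchy-Schwarz inequality gives the constant `‖P_{𝒲⊥}‖ = √(s - r)`. For the Frobenius norm of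
`DK` no such factor is lost: moving a single entry of the `l`-th column of `X` changes only the
`l`-th row and column of `K(X)`, so the corresponding column of the Jacobian is a symmetric matrix
`u vᵀ + v uᵀ`, whose pairing with an orthogonal projection `P` is `⟪u, v⟫ + ⟪u, R v⟫` with the
reflection `R = 2 P - 1`, and this is at most the Frobenius norm of `u vᵀ + v uᵀ`.

In the direction of `𝒲`, a horizontal geodesic satisfies `γ'' = -γ γ'ᵀ γ'` and has constant speed.
The second derivative of `trace K - ⟪γ, K γ⟫` along it is therefore
`-2 (⟪γ', K γ'⟫ - ⟪γ γ'ᵀ, K γ γ'ᵀ⟫)`. As `K` is positive semidefinite, both quadratic forms lie in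
`[0, ‖K‖ ‖γ'‖ ^ 2]`. -/

namespace KernelRecovery

section Taylor

variable {E : Type*} [NormedAddCommGroup E] [NormedSpace ℝ E] {C : ℝ}

theorem norm_sub_le_of_norm_deriv_sub_le {ψ ψ' : ℝ → E}
    (hψ : ∀ t ∈ Set.Icc (0 : ℝ) 1, HasDerivAt ψ (ψ' t) t)
    (hC : ∀ t ∈ Set.Icc (0 : ℝ) 1, ‖ψ' t - ψ' 0‖ ≤ C * t) :
    ‖ψ 1 - (ψ 0 + ψ' 0)‖ ≤ C / 2 := by
  have hremainder : ∀ t ∈ Set.Icc (0 : ℝ) 1,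
      HasDerivAt (fun t => ψ t - (ψ 0 + t • ψ' 0)) (ψ' t - ψ' 0) t := fun t ht => by
    simpa using (hψ t ht).fun_sub (((hasDerivAt_id t).smul_const (ψ' 0)).const_add (ψ 0))
  have hbound : ∀ t, HasDerivAt (fun t : ℝ => C / 2 * t ^ 2) (C * t) t := fun t =>
    ((hasDerivAt_pow 2 t).const_mul (C / 2)).congr_deriv (by push_cast; ring)
  simpa using image_norm_le_of_norm_deriv_right_le_deriv_boundary
    (fun t ht => (hremainder t ht).continuousAt.continuousWithinAt)
    (fun t ht => (hremainder t (Set.Ico_subset_Icc_self ht)).hasDerivWithinAt) (by simp) hbound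
    (fun t ht => hC t (Set.Ico_subset_Icc_self ht)) (Set.right_mem_Icc.2 zero_le_one)

theorem norm_sub_le_of_norm_deriv_deriv_le {ψ ψ' ψ'' : ℝ → E}
    (hψ : ∀ t ∈ Set.Icc (0 : ℝ) 1, HasDerivAt ψ (ψ' t) t)
    (hψ' : ∀ t ∈ Set.Icc (0 : ℝ) 1, HasDerivAt ψ' (ψ'' t) t)
    (hC : ∀ t ∈ Set.Icc (0 : ℝ) 1, ‖ψ'' t‖ ≤ C) :
    ‖ψ 1 - (ψ 0 + ψ' 0)‖ ≤ C / 2 := by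
  refine norm_sub_le_of_norm_deriv_sub_le hψ fun t ht => ?_
  simpa using norm_image_sub_le_of_norm_deriv_le_segment'
    (fun u hu => (hψ' u hu).hasDerivWithinAt) (fun u hu => hC u (Set.Ico_subset_Icc_self hu)) t ht

theorem norm_sub_le_of_norm_fderiv_sub_le {G : Type*} [NormedAddCommGroup G] [NormedSpace ℝ G]
    {g : E → G} {x η : E} (hg : ∀ t ∈ Set.Icc (0 : ℝ) 1, DifferentiableAt ℝ g (x + t • η))
    (hC : ∀ t ∈ Set.Icc (0 : ℝ) 1, ‖fderiv ℝ g (x + t • η) η - fderiv ℝ g x η‖ ≤ C * t) :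
    ‖g (x + η) - (g x + fderiv ℝ g x η)‖ ≤ C / 2 := by
  have hcurve : ∀ t ∈ Set.Icc (0 : ℝ) 1,
      HasDerivAt (fun t : ℝ => g (x + t • η)) (fderiv ℝ g (x + t • η) η) t := fun t ht => by
    have hline : HasDerivAt (fun t : ℝ => x + t • η) η t := by
      simpa using ((hasDerivAt_id t).smul_const η).const_add x
    exact (hg t ht).hasFDerivAt.comp_hasDerivAt t hline
  simpa using norm_sub_le_of_norm_deriv_sub_le hcurve (by simpa using hC)

end Taylor

section Frobenius

variable {p q l : ℕ}

/-- The space of real matrices with the inner product `trace (Aᵀ B)`, whose norm is the Frobenius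
norm. It is a local instance, so that Mathlib's theory of inner product spaces applies to
`frobInner`. -/
noncomputable abbrev frobeniusInnerProductSpace (p q : ℕ) :
    InnerProductSpace ℝ (Matrix (Fin p) (Fin q) ℝ) where
  toNormedSpace := Matrix.frobeniusNormedSpace
  inner := frobInner
  norm_sq_eq_re_inner A := by
    rw [Matrix.frobenius_norm_def, ← Real.sqrt_eq_rpow, Real.sq_sqrt (by positivity),
      Finset.sum_comm]
    simp [frobInner, Matrix.trace, Matrix.mul_apply, sq]
  conj_inner_symm A B := by
    simpa [frobInner] using (Matrix.trace_transpose (Bᵀ * A)).symm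
  add_left A B C := by simp [frobInner, Matrix.add_mul]
  smul_left A B c := by simp [frobInner]

attribute [local instance] frobeniusInnerProductSpace

theorem frobInner_eq_inner (A B : Matrix (Fin p) (Fin q) ℝ) : frobInner A B = inner ℝ A B :=
  rfl

theorem inner_eq_sum (A B : Matrix (Fin p) (Fin q) ℝ) :
    inner ℝ A B = ∑ i, ∑ j, A i j * B i j := by
  rw [← frobInner_eq_inner, Finset.sum_comm]
  simp only [frobInner, Matrix.trace, Matrix.diag, Matrix.mul_apply, Matrix.transpose_apply]

theorem inner_mul_left_eq_inner_transpose_mul (A : Matrix (Fin p) (Fin l) ℝ)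
    (B : Matrix (Fin l) (Fin q) ℝ) (C : Matrix (Fin p) (Fin q) ℝ) :
    inner ℝ (A * B) C = inner ℝ B (Aᵀ * C) := by
  simp only [← frobInner_eq_inner, frobInner, Matrix.transpose_mul, Matrix.mul_assoc]

theorem inner_mul_left_eq_inner_mul_transpose (A : Matrix (Fin p) (Fin l) ℝ)
    (B : Matrix (Fin l) (Fin q) ℝ) (C : Matrix (Fin p) (Fin q) ℝ) :
    inner ℝ (A * B) C = inner ℝ A (C * Bᵀ) := by
  rw [← frobInner_eq_inner, ← frobInner_eq_inner, frobInner, frobInner, Matrix.transpose_mul,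
    Matrix.mul_assoc, Matrix.trace_mul_comm, Matrix.mul_assoc]

theorem exists_isRiemannianGradient {g : Matrix (Fin p) (Fin q) ℝ → ℝ}
    {x : Matrix (Fin p) (Fin q) ℝ} (T : Submodule ℝ (Matrix (Fin p) (Fin q) ℝ))
    (hg : DifferentiableAt ℝ g x) : ∃ G, IsRiemannianGradient g x T G := by
  refine ⟨T.starProjection (gradient g x), T.starProjection_apply_mem _, hg, fun Z hZ => ?_⟩
  rw [frobInner_eq_inner, T.inner_starProjection_left_eq_right,
    Submodule.starProjection_eq_self_iff.2 hZ]
  exact (inner_gradient_left).symm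

theorem isBoundedBilinearMap_matrix_mul {𝕜 m n o : Type*} [RCLike 𝕜] [Fintype m] [Fintype n]
    [Fintype o] :
    IsBoundedBilinearMap 𝕜 fun A : Matrix m n 𝕜 × Matrix n o 𝕜 => A.1 * A.2 where
  add_left := Matrix.add_mul
  smul_left := Matrix.smul_mul
  add_right := Matrix.mul_add
  smul_right c A B := Matrix.mul_smul A c B
  bound := ⟨1, one_pos, fun A B => by simpa using Matrix.frobenius_norm_mul A B⟩

theorem isBoundedLinearMap_matrix_transpose {𝕜 m n : Type*} [RCLike 𝕜] [Fintype m] [Fintype n] :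
    IsBoundedLinearMap 𝕜 fun A : Matrix m n 𝕜 => Aᵀ where
  map_add := Matrix.transpose_add
  map_smul := Matrix.transpose_smul
  bound := ⟨1, one_pos, fun A => by rw [Matrix.frobenius_norm_transpose, one_mul]⟩

theorem hasDerivAt_matrix_transpose {𝕜 m n : Type*} [RCLike 𝕜] [Finite m] [Finite n]
    {A : 𝕜 → Matrix m n 𝕜} {A' : Matrix m n 𝕜} {t : 𝕜} (hA : HasDerivAt A A' t) :
    HasDerivAt (fun t => (A t)ᵀ) A'ᵀ t := by
  have := Fintype.ofFinite m
  have := Fintype.ofFinite n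
  exact HasFDerivAt.comp_hasDerivAt (l := Matrix.transpose) (f := A) t
    isBoundedLinearMap_matrix_transpose.hasFDerivAt hA

theorem hasDerivAt_matrix_mul {𝕜 m n o : Type*} [RCLike 𝕜] [Finite m] [Fintype n] [Finite o]
    {A : 𝕜 → Matrix m n 𝕜} {A' : Matrix m n 𝕜} {B : 𝕜 → Matrix n o 𝕜} {B' : Matrix n o 𝕜} {t : 𝕜}
    (hA : HasDerivAt A A' t) (hB : HasDerivAt B B' t) :
    HasDerivAt (fun t => A t * B t) (A t * B' + A' * B t) t := by
  have := Fintype.ofFinite m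
  have := Fintype.ofFinite o
  exact HasFDerivAt.comp_hasDerivAt (l := fun p : Matrix m n 𝕜 × Matrix n o 𝕜 => p.1 * p.2)
    (f := fun t => (A t, B t)) t
    (isBoundedBilinearMap_matrix_mul.hasFDerivAt (A t, B t)) (hA.prodMk hB)

theorem differentiableAt_matrix_mul {𝕜 E m n o : Type*} [RCLike 𝕜] [NormedAddCommGroup E]
    [NormedSpace 𝕜 E] [Finite m] [Fintype n] [Finite o] {A : E → Matrix m n 𝕜}
    {B : E → Matrix n o 𝕜} {x : E} (hA : DifferentiableAt 𝕜 A x) (hB : DifferentiableAt 𝕜 B x) :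
    DifferentiableAt 𝕜 (fun x => A x * B x) x := by
  have := Fintype.ofFinite m
  have := Fintype.ofFinite o
  exact DifferentiableAt.comp (g := fun p : Matrix m n 𝕜 × Matrix n o 𝕜 => p.1 * p.2)
    (f := fun x => (A x, B x)) x
    (isBoundedBilinearMap_matrix_mul.differentiableAt (A x, B x)) (hA.prodMk hB)

theorem norm_mul_of_mem_stiefel {W : Matrix (Fin p) (Fin l) ℝ} (hW : W ∈ stiefel p l)
    (A : Matrix (Fin l) (Fin q) ℝ) : ‖W * A‖ = ‖A‖ := by
  have hW' : Wᵀ * W = 1 := hW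
  rw [← sq_eq_sq₀ (norm_nonneg _) (norm_nonneg _), ← real_inner_self_eq_norm_sq,
    ← real_inner_self_eq_norm_sq, inner_mul_left_eq_inner_transpose_mul, ← Matrix.mul_assoc, hW',
    Matrix.one_mul]

theorem inner_mul_self_mem_Icc {K : Matrix (Fin p) (Fin p) ℝ} (hK : K.PosSemidef)
    (A : Matrix (Fin p) (Fin q) ℝ) : inner ℝ A (K * A) ∈ Set.Icc 0 (‖K‖ * ‖A‖ ^ 2) := by
  constructor
  · simpa [← frobInner_eq_inner, frobInner, Matrix.mul_assoc] using
      (hK.conjTranspose_mul_mul_same A).trace_nonneg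
  · calc inner ℝ A (K * A) ≤ ‖A‖ * ‖K * A‖ := real_inner_le_norm _ _
      _ ≤ ‖A‖ * (‖K‖ * ‖A‖) := by gcongr; exact Matrix.frobenius_norm_mul _ _
      _ = ‖K‖ * ‖A‖ ^ 2 := by ring

theorem abs_apply_le_jacobianFrobNorm_mul
    {D : Matrix (Fin p) (Fin q) ℝ →ₗ[ℝ] Matrix (Fin q) (Fin q) ℝ}
    {ℓ : Matrix (Fin q) (Fin q) ℝ →ₗ[ℝ] ℝ}
    (hℓ : ∀ a i, |ℓ (D (Matrix.single a i 1))| ≤ ‖D (Matrix.single a i 1)‖)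
    (Z : Matrix (Fin p) (Fin q) ℝ) : |ℓ (D Z)| ≤ jacobianFrobNorm D * ‖Z‖ := by
  let A : Matrix (Fin p) (Fin q) ℝ := Matrix.of fun a i => ℓ (D (Matrix.single a i 1))
  have hrepr : ℓ (D Z) = inner ℝ A Z := by
    have hsingle : ∀ a i, Matrix.single a i (Z a i) = Z a i • Matrix.single a i 1 := by simp
    conv_lhs => rw [Matrix.matrix_eq_sum_single Z]
    simp only [hsingle, map_sum, map_smul, smul_eq_mul, inner_eq_sum, A, Matrix.of_apply, mul_comm]
  have hA : ‖A‖ ≤ jacobianFrobNorm D := by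
    rw [norm_eq_sqrt_real_inner (F := Matrix (Fin p) (Fin q) ℝ), inner_eq_sum, jacobianFrobNorm]
    gcongr with a _ i
    rw [← sq]
    exact sq_le_sq.2 ((hℓ a i).trans_eq (abs_norm _).symm)
  calc |ℓ (D Z)| ≤ ‖A‖ * ‖Z‖ := hrepr ▸ abs_real_inner_le_norm A Z
    _ ≤ jacobianFrobNorm D * ‖Z‖ := by gcongr

end Frobenius

section Projection

attribute [local instance] frobeniusInnerProductSpace

variable {s r : ℕ}

theorem isStarProjection_projMatrix (𝒲 : Submodule ℝ (EuclideanSpace ℝ (Fin s))) :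
    IsStarProjection (projMatrix 𝒲) where
  isIdempotentElem := by
    rw [IsIdempotentElem, projMatrix, ← map_mul, 𝒲.isIdempotentElem_starProjection.eq]
  isSelfAdjoint :=
    (Matrix.toEuclideanCLM.symm.map_star' _).symm.trans
      (congrArg (Matrix.toEuclideanCLM (𝕜 := ℝ) (n := Fin s)).symm
        (isSelfAdjoint_starProjection 𝒲).star_eq)

theorem transpose_projMatrix (𝒲 : Submodule ℝ (EuclideanSpace ℝ (Fin s))) :
    (projMatrix 𝒲)ᵀ = projMatrix 𝒲 := by
  simpa [Matrix.star_eq_conjTranspose] using (isStarProjection_projMatrix 𝒲).isSelfAdjoint.star_eq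

theorem projMatrix_orthogonal (𝒲 : Submodule ℝ (EuclideanSpace ℝ (Fin s))) :
    projMatrix 𝒲ᗮ = 1 - projMatrix 𝒲 := by
  rw [projMatrix, projMatrix, Submodule.starProjection_orthogonal', map_sub, map_one]

theorem toEuclideanLin_projMatrix (𝒲 : Submodule ℝ (EuclideanSpace ℝ (Fin s))) :
    Matrix.toEuclideanLin (projMatrix 𝒲) = 𝒲.starProjection.toLinearMap := by
  rw [projMatrix, ← Matrix.coe_toEuclideanCLM_eq_toEuclideanLin, StarAlgEquiv.apply_symm_apply]

theorem trace_projMatrix (𝒲 : Submodule ℝ (EuclideanSpace ℝ (Fin s))) :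
    (projMatrix 𝒲).trace = Module.finrank ℝ 𝒲 := by
  have hproj : LinearMap.IsProj 𝒲 𝒲.starProjection.toLinearMap :=
    ⟨𝒲.starProjection_apply_mem, fun _ => Submodule.starProjection_eq_self_iff.2⟩
  rw [← hproj.trace, ← toEuclideanLin_projMatrix]
  exact (Matrix.trace_toLin_eq _ (PiLp.basisFun 2 ℝ (Fin s))).symm

theorem norm_projMatrix (𝒲 : Submodule ℝ (EuclideanSpace ℝ (Fin s))) :
    ‖projMatrix 𝒲‖ = √(Module.finrank ℝ 𝒲) := by
  rw [norm_eq_sqrt_real_inner (F := Matrix (Fin s) (Fin s) ℝ), ← frobInner_eq_inner, frobInner,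
    transpose_projMatrix, (isStarProjection_projMatrix 𝒲).isIdempotentElem.eq, trace_projMatrix]

theorem norm_projMatrix_orthogonal_colSpace {W : Matrix (Fin s) (Fin r) ℝ} (hW : W ∈ stiefel s r) :
    ‖projMatrix (colSpace W)ᗮ‖ = √((s : ℝ) - r) := by
  have hdim : Module.finrank ℝ (colSpace W) = r := colSpace_mem_grass hW
  have hsum := (colSpace W).finrank_add_finrank_orthogonal
  rw [hdim, finrank_euclideanSpace_fin] at hsum
  rw [norm_projMatrix, ← (Nat.cast_inj (R := ℝ)).2 hsum, Nat.cast_add, add_sub_cancel_left]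

theorem projMatrix_colSpace {V : Matrix (Fin s) (Fin r) ℝ} (hV : IsUnit (Vᵀ * V)) :
    projMatrix (colSpace V) = V * (Vᵀ * V)⁻¹ * Vᵀ := by
  rw [projMatrix, StarAlgEquiv.symm_apply_eq]
  refine ContinuousLinearMap.ext fun x =>
    Submodule.eq_starProjection_of_mem_of_inner_eq_zero (K := colSpace V) ?_ ?_
  · exact ⟨WithLp.toLp 2 (((Vᵀ * V)⁻¹ * Vᵀ) *ᵥ x.ofLp), WithLp.ofLp_injective 2 (by
      simp [Matrix.toLpLin_apply, Matrix.mulVec_mulVec, Matrix.mul_assoc])⟩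
  · rintro _ ⟨y, rfl⟩
    have hnormal : Vᵀ * (V * (Vᵀ * V)⁻¹ * Vᵀ) = Vᵀ := by
      rw [← Matrix.mul_assoc, ← Matrix.mul_assoc,
        Matrix.mul_nonsing_inv _ ((Matrix.isUnit_iff_isUnit_det _).1 hV), Matrix.one_mul]
    have hresidual : Vᵀ *ᵥ (x.ofLp - (V * (Vᵀ * V)⁻¹ * Vᵀ) *ᵥ x.ofLp) = 0 := by
      rw [Matrix.mulVec_sub, Matrix.mulVec_mulVec, hnormal, sub_self]
    simp only [EuclideanSpace.inner_eq_star_dotProduct, star_trivial, WithLp.ofLp_sub,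
      Matrix.ofLp_toEuclideanCLM, Matrix.toLpLin_apply]
    rw [dotProduct_comm, Matrix.dotProduct_mulVec, ← Matrix.mulVec_transpose, hresidual,
      zero_dotProduct]

theorem inner_vecMulVec_vecMulVec (u v w x : Fin s → ℝ) :
    inner ℝ (Matrix.vecMulVec u v) (Matrix.vecMulVec w x) = (u ⬝ᵥ w) * (v ⬝ᵥ x) := by
  rw [← frobInner_eq_inner, frobInner, Matrix.transpose_vecMulVec, Matrix.vecMulVec_mul_vecMulVec,
    Matrix.trace_vecMulVec, dotProduct_smul, smul_eq_mul]

theorem inner_projMatrix_vecMulVec (𝒲 : Submodule ℝ (EuclideanSpace ℝ (Fin s)))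
    (u v : EuclideanSpace ℝ (Fin s)) :
    inner ℝ (projMatrix 𝒲) (Matrix.vecMulVec u v) = inner ℝ u (𝒲.starProjection v) := by
  have hmulVec : projMatrix 𝒲 *ᵥ u.ofLp = (𝒲.starProjection u).ofLp :=
    congrArg WithLp.ofLp (DFunLike.congr_fun (toEuclideanLin_projMatrix 𝒲) u)
  rw [← frobInner_eq_inner, frobInner, transpose_projMatrix, Matrix.mul_vecMulVec,
    Matrix.trace_vecMulVec, hmulVec, ← 𝒲.inner_starProjection_left_eq_right,
    EuclideanSpace.inner_eq_star_dotProduct, dotProduct_comm, star_trivial]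

theorem norm_vecMulVec_add_sq (u v : EuclideanSpace ℝ (Fin s)) :
    ‖Matrix.vecMulVec u.ofLp v.ofLp + Matrix.vecMulVec v.ofLp u.ofLp‖ ^ 2 =
      2 * ((‖u‖ * ‖v‖) ^ 2 + inner ℝ u v ^ 2) := by
  rw [← real_inner_self_eq_norm_sq, mul_pow, ← real_inner_self_eq_norm_sq,
    ← real_inner_self_eq_norm_sq]
  simp only [inner_add_left, inner_add_right, inner_vecMulVec_vecMulVec,
    EuclideanSpace.inner_eq_star_dotProduct, star_trivial, dotProduct_comm v.ofLp u.ofLp]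
  ring

theorem abs_inner_projMatrix_vecMulVec_add_le (𝒲 : Submodule ℝ (EuclideanSpace ℝ (Fin s)))
    (u v : EuclideanSpace ℝ (Fin s)) :
    |inner ℝ (projMatrix 𝒲) (Matrix.vecMulVec u v + Matrix.vecMulVec v u)| ≤
      ‖Matrix.vecMulVec u.ofLp v.ofLp + Matrix.vecMulVec v.ofLp u.ofLp‖ := by
  have hsymm : inner ℝ v (𝒲.starProjection u) = inner ℝ u (𝒲.starProjection v) := by
    rw [← 𝒲.inner_starProjection_left_eq_right, real_inner_comm]
  have hreflection : 2 * inner ℝ u (𝒲.starProjection v) =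
      inner ℝ u v + inner ℝ u (𝒲.reflection v) := by
    rw [Submodule.reflection_apply, inner_sub_right, inner_smul_right_eq_smul, nsmul_eq_mul]
    push_cast
    ring
  have hcauchy : inner ℝ u (𝒲.reflection v) ^ 2 ≤ (‖u‖ * ‖v‖) ^ 2 := by
    rw [← 𝒲.reflection.norm_map v]
    exact sq_le_sq' (neg_le_of_abs_le (abs_real_inner_le_norm _ _)) (real_inner_le_norm _ _)
  refine abs_le_of_sq_le_sq ?_ (norm_nonneg _)
  rw [inner_add_right, inner_projMatrix_vecMulVec, inner_projMatrix_vecMulVec, hsymm, ← two_mul,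
    hreflection, norm_vecMulVec_add_sq]
  exact add_sq_le.trans (by linarith)

theorem exists_eq_vecMulVec_single_add {U : Matrix (Fin s) (Fin s) ℝ} (hU : Uᵀ = U) (l : Fin s)
    (hl : ∀ i j, i ≠ l → j ≠ l → U i j = 0) :
    ∃ w : Fin s → ℝ,
      U = Matrix.vecMulVec (Pi.single l 1) w + Matrix.vecMulVec w (Pi.single l 1) := by
  have hsymm : ∀ i j, U i j = U j i := fun i j => congrFun₂ hU j i
  refine ⟨Function.update (U l) l (U l l / 2), ?_⟩
  ext i j
  by_cases hi : i = l <;> by_cases hj : j = l <;>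
    simp_all [Matrix.vecMulVec_apply]

end Projection

section Kernel

variable {F : Type*} [NormedAddCommGroup F] [InnerProductSpace ℝ F] {n s : ℕ}
  {φ : (Fin n → ℝ) → F}

theorem posSemidef_kernelMatrix (φ : (Fin n → ℝ) → F) (X : Matrix (Fin n) (Fin s) ℝ) :
    (kernelMatrix φ X).PosSemidef :=
  Matrix.posSemidef_gram ℝ fun i => φ (Xᵀ i)

theorem transpose_kernelMatrix (φ : (Fin n → ℝ) → F) (X : Matrix (Fin n) (Fin s) ℝ) :
    (kernelMatrix φ X)ᵀ = kernelMatrix φ X := by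
  simpa using (posSemidef_kernelMatrix φ X).isHermitian.eq

theorem transpose_kernelDeriv_apply {X : Matrix (Fin n) (Fin s) ℝ}
    (hX : DifferentiableAt ℝ (kernelMatrix φ) X) (Z : Matrix (Fin n) (Fin s) ℝ) :
    (kernelDeriv φ X Z)ᵀ = kernelDeriv φ X Z := by
  have hcomp : HasFDerivAt (kernelMatrix φ) _ X :=
    ((isBoundedLinearMap_matrix_transpose.hasFDerivAt (x := kernelMatrix φ X)).comp X
      hX.hasFDerivAt).congr_of_eventuallyEq (.of_forall fun Y => (transpose_kernelMatrix φ Y).symm)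
  exact DFunLike.congr_fun (hcomp.unique hX.hasFDerivAt) Z

theorem kernelDeriv_single_apply_eq_zero {X : Matrix (Fin n) (Fin s) ℝ}
    (hX : DifferentiableAt ℝ (kernelMatrix φ) X) (a : Fin n) {l i j : Fin s}
    (hi : i ≠ l) (hj : j ≠ l) : kernelDeriv φ X (Matrix.single a l 1) i j = 0 := by
  let ε : Matrix (Fin s) (Fin s) ℝ →L[ℝ] ℝ :=
    (Matrix.entryLinearMap ℝ ℝ i j).toContinuousLinearMap
  have hentry : HasLineDerivAt ℝ (fun Y => kernelMatrix φ Y i j)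
      (kernelDeriv φ X (Matrix.single a l 1) i j) X (Matrix.single a l 1) :=
    (ε.hasFDerivAt.comp X hX.hasFDerivAt).hasLineDerivAt _
  have hcol : ∀ (t : ℝ) (k : Fin s), k ≠ l → (X + t • Matrix.single a l 1)ᵀ k = Xᵀ k :=
    fun t k hk => by ext c; simp [hk.symm]
  have hconst : HasLineDerivAt ℝ (fun Y => kernelMatrix φ Y i j) 0 X (Matrix.single a l 1) :=
    (hasDerivAt_const (0 : ℝ) (kernelMatrix φ X i j)).congr_of_eventuallyEq
      (.of_forall fun t => by simp only [kernelMatrix, Matrix.of_apply, hcol t i hi, hcol t j hj])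
  exact hentry.unique hconst

end Kernel

section MeasurementDirection

attribute [local instance] frobeniusInnerProductSpace

variable {F : Type*} [NormedAddCommGroup F] [InnerProductSpace ℝ F] {n s m r : ℕ}
  {φ : (Fin n → ℝ) → F}

theorem kernelCost_eq_inner (X : Matrix (Fin n) (Fin s) ℝ)
    (𝒲 : Submodule ℝ (EuclideanSpace ℝ (Fin s))) :
    kernelCost φ X 𝒲 = inner ℝ (projMatrix 𝒲ᗮ) (kernelMatrix φ X) := by
  rw [← frobInner_eq_inner, frobInner, transpose_projMatrix, kernelCost]

theorem hasFDerivAt_kernelCost {X : Matrix (Fin n) (Fin s) ℝ}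
    (hX : DifferentiableAt ℝ (kernelMatrix φ) X) (𝒲 : Submodule ℝ (EuclideanSpace ℝ (Fin s))) :
    HasFDerivAt (fun Y => kernelCost φ Y 𝒲)
      (innerSL ℝ (projMatrix 𝒲ᗮ) ∘L fderiv ℝ (kernelMatrix φ) X) X := by
  simp only [kernelCost_eq_inner]
  exact (innerSL ℝ (projMatrix 𝒲ᗮ)).hasFDerivAt.comp X hX.hasFDerivAt

theorem abs_inner_projMatrix_kernelDeriv_sub_le {X₁ X₂ : Matrix (Fin n) (Fin s) ℝ}
    (h₁ : DifferentiableAt ℝ (kernelMatrix φ) X₁) (h₂ : DifferentiableAt ℝ (kernelMatrix φ) X₂)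
    (𝒲 : Submodule ℝ (EuclideanSpace ℝ (Fin s))) (Z : Matrix (Fin n) (Fin s) ℝ) :
    |inner ℝ (projMatrix 𝒲) ((kernelDeriv φ X₁ - kernelDeriv φ X₂) Z)| ≤
      jacobianFrobNorm (kernelDeriv φ X₁ - kernelDeriv φ X₂) * ‖Z‖ := by
  refine abs_apply_le_jacobianFrobNorm_mul (ℓ := (innerSL ℝ (projMatrix 𝒲)).toLinearMap)
    (fun a l => ?_) Z
  obtain ⟨w, hw⟩ := exists_eq_vecMulVec_single_add
    (U := (kernelDeriv φ X₁ - kernelDeriv φ X₂) (Matrix.single a l 1))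
    (by simp only [LinearMap.sub_apply, Matrix.transpose_sub, transpose_kernelDeriv_apply h₁,
      transpose_kernelDeriv_apply h₂]) l
    (fun i j hi hj => by simp only [LinearMap.sub_apply, Matrix.sub_apply,
      kernelDeriv_single_apply_eq_zero h₁ a hi hj, kernelDeriv_single_apply_eq_zero h₂ a hi hj,
      sub_zero])
  rw [hw]
  exact abs_inner_projMatrix_vecMulVec_add_le 𝒲 (WithLp.toLp 2 (Pi.single l 1)) (WithLp.toLp 2 w)

theorem grassExp_zero (W : Matrix (Fin s) (Fin r) ℝ) : grassExp W 0 = colSpace W := by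
  simp [grassExp, grassGeodesic]

theorem pullbackLipschitzX_of_fderiv_lipschitz
    {f : Matrix (Fin n) (Fin s) ℝ → Submodule ℝ (EuclideanSpace ℝ (Fin s)) → ℝ}
    {𝒜 : Matrix (Fin n) (Fin s) ℝ →ₗ[ℝ] (Fin m → ℝ)} {b : Fin m → ℝ} {C : ℝ}
    (hf : ∀ X ∈ measurementSpace 𝒜 b, ∀ W ∈ stiefel s r,
      DifferentiableAt ℝ (fun Y => f Y (colSpace W)) X)
    (hC : ∀ X₁ ∈ measurementSpace 𝒜 b, ∀ X₂ ∈ measurementSpace 𝒜 b, ∀ W ∈ stiefel s r, ∀ Z,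
      |fderiv ℝ (fun Y => f Y (colSpace W)) X₁ Z - fderiv ℝ (fun Y => f Y (colSpace W)) X₂ Z| ≤
        C * ‖X₁ - X₂‖ * ‖Z‖) :
    PullbackLipschitzX r f 𝒜 b C := by
  intro X hX W hW
  obtain ⟨G, hG⟩ := exists_isRiemannianGradient (LinearMap.ker 𝒜) (hf X hX W hW)
  refine ⟨G, hG, fun η hη => ?_⟩
  have hmem : ∀ t : ℝ, X + t • η ∈ measurementSpace 𝒜 b := fun t => by
    rw [measurementSpace, Set.mem_ofPred_eq, map_add, map_smul, LinearMap.mem_ker.1 hη, smul_zero,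
      add_zero]
    exact hX
  rw [← hG.2.2 η hη, expRetr, Function.uncurry_apply_pair, grassExp_zero, div_mul_eq_mul_div]
  refine norm_sub_le_of_norm_fderiv_sub_le (fun t _ => hf _ (hmem t) W hW) fun t ht => ?_
  refine (hC _ (hmem t) X hX W hW η).trans_eq ?_
  rw [add_sub_cancel_left, norm_smul, Real.norm_of_nonneg ht.1]
  ring

theorem pullbackLipschitzX_kernelCost {𝒜 : Matrix (Fin n) (Fin s) ℝ →ₗ[ℝ] (Fin m → ℝ)}
    {b : Fin m → ℝ} {C : ℝ}
    (hK : ∀ X ∈ measurementSpace 𝒜 b, DifferentiableAt ℝ (kernelMatrix φ (s := s)) X)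
    (hC : ∀ X₁ ∈ measurementSpace 𝒜 b, ∀ X₂ ∈ measurementSpace 𝒜 b, ∀ W ∈ stiefel s r, ∀ Z,
      |inner ℝ (projMatrix (colSpace W)ᗮ) ((kernelDeriv φ X₁ - kernelDeriv φ X₂) Z)| ≤
        C * ‖X₁ - X₂‖ * ‖Z‖) :
    PullbackLipschitzX r (kernelCost φ) 𝒜 b C := by
  refine pullbackLipschitzX_of_fderiv_lipschitz
    (fun X hX W _ => (hasFDerivAt_kernelCost (hK X hX) _).differentiableAt)
    fun X₁ h₁ X₂ h₂ W hW Z => ?_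
  rw [(hasFDerivAt_kernelCost (hK X₁ h₁) _).fderiv, (hasFDerivAt_kernelCost (hK X₂ h₂) _).fderiv]
  have hZ := hC X₁ h₁ X₂ h₂ W hW Z
  rw [LinearMap.sub_apply, inner_sub_right] at hZ
  exact hZ

theorem pullbackLipschitzX_kernelCost_of_jacobianFrobNorm_le
    {𝒜 : Matrix (Fin n) (Fin s) ℝ →ₗ[ℝ] (Fin m → ℝ)} {b : Fin m → ℝ} {L : ℝ}
    (hK : ∀ X ∈ measurementSpace 𝒜 b, DifferentiableAt ℝ (kernelMatrix φ (s := s)) X)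
    (hL : ∀ X₁ ∈ measurementSpace 𝒜 b, ∀ X₂ ∈ measurementSpace 𝒜 b,
      jacobianFrobNorm (kernelDeriv φ X₁ - kernelDeriv φ X₂) ≤ L * ‖X₁ - X₂‖) :
    PullbackLipschitzX r (kernelCost φ) 𝒜 b L := by
  refine pullbackLipschitzX_kernelCost hK fun X₁ h₁ X₂ h₂ W _ Z => ?_
  refine (abs_inner_projMatrix_kernelDeriv_sub_le (hK X₁ h₁) (hK X₂ h₂) _ Z).trans ?_
  gcongr
  exact hL X₁ h₁ X₂ h₂

theorem pullbackLipschitzX_kernelCost_of_norm_kernelDeriv_sub_le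
    {𝒜 : Matrix (Fin n) (Fin s) ℝ →ₗ[ℝ] (Fin m → ℝ)} {b : Fin m → ℝ} {L : ℝ}
    (hK : ∀ X ∈ measurementSpace 𝒜 b, DifferentiableAt ℝ (kernelMatrix φ (s := s)) X)
    (hL : ∀ X₁ ∈ measurementSpace 𝒜 b, ∀ X₂ ∈ measurementSpace 𝒜 b, ∀ Z,
      ‖kernelDeriv φ X₁ Z - kernelDeriv φ X₂ Z‖ ≤ L * ‖X₁ - X₂‖ * ‖Z‖) :
    PullbackLipschitzX r (kernelCost φ) 𝒜 b (√((s : ℝ) - r) * L) := by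
  refine pullbackLipschitzX_kernelCost hK fun X₁ h₁ X₂ h₂ W hW Z => ?_
  refine (abs_real_inner_le_norm _ _).trans ?_
  rw [norm_projMatrix_orthogonal_colSpace hW, mul_assoc √_, mul_assoc √_]
  gcongr
  exact hL X₁ h₁ X₂ h₂ Z

end MeasurementDirection

section GrassmannDirection

attribute [local instance] frobeniusInnerProductSpace

variable {s r : ℕ}

theorem inner_projMatrix_orthogonal_colSpace (K : Matrix (Fin s) (Fin s) ℝ)
    {V : Matrix (Fin s) (Fin r) ℝ} (hV : IsUnit (Vᵀ * V)) :
    inner ℝ (projMatrix (colSpace V)ᗮ) K =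
      K.trace - inner ℝ V (K * (V * (Vᵀ * V)⁻¹)) := by
  rw [← frobInner_eq_inner, ← frobInner_eq_inner, frobInner, frobInner, transpose_projMatrix,
    projMatrix_orthogonal, projMatrix_colSpace hV, Matrix.sub_mul, Matrix.one_mul,
    Matrix.trace_sub, Matrix.mul_assoc, Matrix.trace_mul_comm, Matrix.mul_assoc]

theorem inner_projMatrix_orthogonal_colSpace_of_mem_stiefel (K : Matrix (Fin s) (Fin s) ℝ)
    {W : Matrix (Fin s) (Fin r) ℝ} (hW : W ∈ stiefel s r) :
    inner ℝ (projMatrix (colSpace W)ᗮ) K = K.trace - inner ℝ W (K * W) := by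
  have hgram : Wᵀ * W = 1 := hW
  rw [inner_projMatrix_orthogonal_colSpace K (hgram ▸ isUnit_one), hgram, inv_one, Matrix.mul_one]

theorem differentiableAt_inner_projMatrix_orthogonal_colSpace (K : Matrix (Fin s) (Fin s) ℝ)
    {W : Matrix (Fin s) (Fin r) ℝ} (hW : IsUnit (Wᵀ * W)) :
    DifferentiableAt ℝ
      (fun V : Matrix (Fin s) (Fin r) ℝ => inner ℝ (projMatrix (colSpace V)ᗮ) K) W := by
  have hgram : Differentiable ℝ fun V : Matrix (Fin s) (Fin r) ℝ => Vᵀ * V := fun V =>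
    differentiableAt_matrix_mul isBoundedLinearMap_matrix_transpose.differentiableAt
      differentiableAt_id
  have hinv : DifferentiableAt ℝ (fun V : Matrix (Fin s) (Fin r) ℝ => (Vᵀ * V)⁻¹) W := by
    simp only [Matrix.nonsing_inv_eq_ringInverse]
    exact DifferentiableAt.comp (f := fun V : Matrix (Fin s) (Fin r) ℝ => Vᵀ * V) W
      (differentiableAt_inverse hW) (hgram W)
  have hK : DifferentiableAt ℝ (fun V : Matrix (Fin s) (Fin r) ℝ => K * (V * (Vᵀ * V)⁻¹)) W :=
    differentiableAt_matrix_mul (differentiableAt_const K)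
      (differentiableAt_matrix_mul differentiableAt_id hinv)
  refine ((differentiableAt_id.inner ℝ hK).const_sub K.trace).congr_of_eventuallyEq ?_
  filter_upwards [hgram.continuous.continuousAt.eventually (Units.isOpen.mem_nhds hW)] with V hV
  exact inner_projMatrix_orthogonal_colSpace K hV

theorem eq_neg_mul_of_orthogonal_tangent {W W₁ W₂ : Matrix (Fin s) (Fin r) ℝ}
    (hW : W ∈ stiefel s r) (hW₂ : Wᵀ * W₂ + W₁ᵀ * W₁ = 0)
    (hnormal : ∀ Z, Wᵀ * Z + Zᵀ * W = 0 → inner ℝ W₂ Z = 0) : W₂ = -(W * (W₁ᵀ * W₁)) := by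
  have hgram : Wᵀ * W = 1 := hW
  set Z := W₂ + W * (W₁ᵀ * W₁) with hZ
  have hhor : Wᵀ * Z = 0 := by
    rw [hZ, Matrix.mul_add, ← Matrix.mul_assoc Wᵀ W, hgram, Matrix.one_mul, hW₂]
  have hhor' : Zᵀ * W = 0 := by simpa using congrArg Matrix.transpose hhor
  have hinner : inner ℝ Z Z = 0 := by
    calc inner ℝ Z Z = inner ℝ W₂ Z + inner ℝ (W * (W₁ᵀ * W₁)) Z := inner_add_left _ _ _
      _ = 0 := by
        rw [hnormal Z (by rw [hhor, hhor', add_zero]), inner_mul_left_eq_inner_transpose_mul,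
          hhor, inner_zero_right, add_zero]
  exact eq_neg_of_add_eq_zero_left (inner_self_eq_zero.1 hinner)

theorem IsHorizontalGeodesic.exists_hasDerivAt {γ : ℝ → Matrix (Fin s) (Fin r) ℝ}
    (hγ : IsHorizontalGeodesic γ) :
    ∃ γ₁ : ℝ → Matrix (Fin s) (Fin r) ℝ, (∀ t, HasDerivAt γ (γ₁ t) t) ∧
      (∀ t, HasDerivAt γ₁ (-(γ t * ((γ₁ t)ᵀ * γ₁ t))) t) ∧ ∀ t, ‖γ₁ t‖ = ‖γ₁ 0‖ := by
  obtain ⟨γ₁, γ₂, hγ₁, hγ₂, hst, hhor, hnormal⟩ := hγ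
  have hhor_deriv : ∀ t, (γ t)ᵀ * γ₂ t + (γ₁ t)ᵀ * γ₁ t = 0 := fun t =>
    (hasDerivAt_matrix_mul (hasDerivAt_matrix_transpose (hγ₁ t)) (hγ₂ t)).unique
      ((hasDerivAt_const t 0).congr_of_eventuallyEq (.of_forall hhor))
  have haccel : ∀ t, γ₂ t = -(γ t * ((γ₁ t)ᵀ * γ₁ t)) := fun t =>
    eq_neg_mul_of_orthogonal_tangent (hst t) (hhor_deriv t) (hnormal t)
  have hpower : ∀ t, inner ℝ (γ₂ t) (γ₁ t) = 0 := fun t => by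
    have hvel : (γ t)ᵀ * γ₁ t = 0 := hhor t
    rw [haccel, inner_neg_left, inner_mul_left_eq_inner_transpose_mul, hvel, inner_zero_right,
      neg_zero]
  have hspeed : ∀ t, HasDerivAt (fun t => inner ℝ (γ₁ t) (γ₁ t)) 0 t := fun t =>
    ((hγ₂ t).inner ℝ (hγ₂ t)).congr_deriv (by rw [real_inner_comm, hpower, add_zero])
  refine ⟨γ₁, hγ₁, fun t => haccel t ▸ hγ₂ t, fun t => ?_⟩
  rw [norm_eq_sqrt_real_inner, norm_eq_sqrt_real_inner, is_const_of_deriv_eq_zero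
    (fun t => (hspeed t).differentiableAt) (fun t => (hspeed t).deriv) t 0]

theorem hasDerivAt_inner_projMatrix_orthogonal_colSpace {K : Matrix (Fin s) (Fin s) ℝ}
    (hK : Kᵀ = K) {γ : ℝ → Matrix (Fin s) (Fin r) ℝ} {H : Matrix (Fin s) (Fin r) ℝ} {t : ℝ}
    (hst : ∀ t, γ t ∈ stiefel s r) (hγ : HasDerivAt γ H t) :
    HasDerivAt (fun t => inner ℝ (projMatrix (colSpace (γ t))ᗮ) K)
      (-2 * inner ℝ (γ t) (K * H)) t := by
  have hKγ : HasDerivAt (fun t => K * γ t) (K * H) t := by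
    simpa using hasDerivAt_matrix_mul (hasDerivAt_const t K) hγ
  have hsymm : inner ℝ H (K * γ t) = inner ℝ (γ t) (K * H) := by
    rw [real_inner_comm, inner_mul_left_eq_inner_transpose_mul, hK]
  simp only [inner_projMatrix_orthogonal_colSpace_of_mem_stiefel K (hst _)]
  exact ((hγ.inner ℝ hKγ).const_sub K.trace).congr_deriv (by rw [hsymm]; ring)

theorem hasDerivAt_inner_mul_of_geodesic {K : Matrix (Fin s) (Fin s) ℝ}
    {γ γ₁ : ℝ → Matrix (Fin s) (Fin r) ℝ} {t : ℝ}
    (hγ : HasDerivAt γ (γ₁ t) t) (hγ₁ : HasDerivAt γ₁ (-(γ t * ((γ₁ t)ᵀ * γ₁ t))) t) :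
    HasDerivAt (fun t => inner ℝ (γ t) (K * γ₁ t))
      (inner ℝ (γ₁ t) (K * γ₁ t) - inner ℝ (γ t * (γ₁ t)ᵀ) (K * (γ t * (γ₁ t)ᵀ))) t := by
  have hKγ₁ : HasDerivAt (fun t => K * γ₁ t) (K * -(γ t * ((γ₁ t)ᵀ * γ₁ t))) t := by
    simpa using hasDerivAt_matrix_mul (hasDerivAt_const t K) hγ₁
  refine (hγ.inner ℝ hKγ₁).congr_deriv ?_
  rw [inner_mul_left_eq_inner_mul_transpose, Matrix.transpose_transpose, Matrix.mul_assoc,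
    Matrix.mul_assoc, Matrix.mul_neg, inner_neg_right]
  ring

theorem abs_inner_projMatrix_geodesic_sub_le {K : Matrix (Fin s) (Fin s) ℝ}
    (hK : K.PosSemidef) {γ : ℝ → Matrix (Fin s) (Fin r) ℝ} {H : Matrix (Fin s) (Fin r) ℝ}
    (hγ : IsHorizontalGeodesic γ) (hH : HasDerivAt γ H 0) :
    |inner ℝ (projMatrix (colSpace (γ 1))ᗮ) K -
      (inner ℝ (projMatrix (colSpace (γ 0))ᗮ) K + -2 * inner ℝ (γ 0) (K * H))| ≤
        ‖K‖ * ‖H‖ ^ 2 := by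
  obtain ⟨γ₁, hγ₁, hγ₂, hspeed⟩ := hγ.exists_hasDerivAt
  obtain ⟨-, -, -, -, hst, -⟩ := hγ
  have hKsymm : Kᵀ = K := by simpa using hK.isHermitian.eq
  rw [hH.unique (hγ₁ 0)]
  have hsecond : ∀ t, ‖-2 * (inner ℝ (γ₁ t) (K * γ₁ t) -
      inner ℝ (γ t * (γ₁ t)ᵀ) (K * (γ t * (γ₁ t)ᵀ)))‖ ≤ 2 * (‖K‖ * ‖γ₁ 0‖ ^ 2) := fun t => by
    have hvel := inner_mul_self_mem_Icc hK (γ₁ t)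
    have hposition := inner_mul_self_mem_Icc hK (γ t * (γ₁ t)ᵀ)
    rw [norm_mul_of_mem_stiefel (hst t), Matrix.frobenius_norm_transpose] at hposition
    rw [norm_mul, norm_neg, Real.norm_two, ← hspeed t]
    gcongr
    simpa using abs_sub_le_of_le_of_le hvel.1 hvel.2 hposition.1 hposition.2
  exact (norm_sub_le_of_norm_deriv_deriv_le
    (fun t _ => hasDerivAt_inner_projMatrix_orthogonal_colSpace hKsymm hst (hγ₁ t))
    (fun t _ => (hasDerivAt_inner_mul_of_geodesic (hγ₁ t) (hγ₂ t)).const_mul (-2))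
    fun t _ => hsecond t).trans_eq (mul_div_cancel_left₀ _ two_ne_zero)

theorem pullbackLipschitzU_kernelCost {F : Type*} [NormedAddCommGroup F] [InnerProductSpace ℝ F]
    {n m : ℕ} {φ : (Fin n → ℝ) → F} {𝒜 : Matrix (Fin n) (Fin s) ℝ →ₗ[ℝ] (Fin m → ℝ)}
    {b : Fin m → ℝ} {M : ℝ} (hM : ∀ X ∈ measurementSpace 𝒜 b, ‖kernelMatrix φ X‖ ≤ M) :
    PullbackLipschitzU r (kernelCost φ) 𝒜 b (2 * M) := by
  intro X hX W hW
  have hgram : Wᵀ * W = 1 := hW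
  have hdiff : DifferentiableAt ℝ (fun V : Matrix (Fin s) (Fin r) ℝ =>
      kernelCost φ X (colSpace V)) W := by
    simp only [kernelCost_eq_inner]
    exact differentiableAt_inner_projMatrix_orthogonal_colSpace _ (hgram ▸ isUnit_one)
  obtain ⟨G, hG⟩ := exists_isRiemannianGradient (horizontal W) hdiff
  refine ⟨G, hG, fun H hH => ?_⟩
  obtain ⟨hgeo, hγ0, hγH⟩ := isHorizontalGeodesic_grassGeodesic hW hH
  have hgrad : -2 * inner ℝ (grassGeodesic W H 0) (kernelMatrix φ X * H) = frobInner G H := by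
    have hst : ∀ t, grassGeodesic W H t ∈ stiefel s r := by
      obtain ⟨-, -, -, -, hst, -⟩ := hgeo
      exact hst
    have hcost : HasFDerivAt (fun V : Matrix (Fin s) (Fin r) ℝ => kernelCost φ X (colSpace V))
        (fderiv ℝ (fun V : Matrix (Fin s) (Fin r) ℝ => kernelCost φ X (colSpace V)) W)
        (grassGeodesic W H 0) := by
      rw [hγ0]
      exact hdiff.hasFDerivAt
    have hdirect : HasDerivAt (fun t => kernelCost φ X (colSpace (grassGeodesic W H t)))
        (-2 * inner ℝ (grassGeodesic W H 0) (kernelMatrix φ X * H)) 0 := by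
      simp only [kernelCost_eq_inner]
      exact hasDerivAt_inner_projMatrix_orthogonal_colSpace (transpose_kernelMatrix φ X) hst hγH
    rw [← hG.2.2 H hH]
    exact hdirect.unique (HasFDerivAt.comp_hasDerivAt (f := grassGeodesic W H) 0 hcost hγH)
  have hbound := abs_inner_projMatrix_geodesic_sub_le (posSemidef_kernelMatrix φ X) hgeo hγH
  rw [hgrad, hγ0, ← kernelCost_eq_inner, ← kernelCost_eq_inner] at hbound
  rw [expRetr, Function.uncurry_apply_pair, add_zero, mul_div_cancel_left₀ M two_ne_zero]
  refine hbound.trans ?_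
  gcongr
  exact hM X hX

end GrassmannDirection

end KernelRecovery

theorem mainTheorem7 {F : Type*} [NormedAddCommGroup F] [InnerProductSpace ℝ F] {n s m : ℕ} (r : ℕ)
    (φ : (Fin n → ℝ) → F)
    (𝒜 : Matrix (Fin n) (Fin s) ℝ →ₗ[ℝ] (Fin m → ℝ)) (b : Fin m → ℝ) :
    ((∀ X ∈ KernelRecovery.measurementSpace 𝒜 b,
        DifferentiableAt ℝ (KernelRecovery.kernelMatrix φ (s := s)) X) →
      (∀ L : ℝ,
        (∀ X₁ ∈ KernelRecovery.measurementSpace 𝒜 b, ∀ X₂ ∈ KernelRecovery.measurementSpace 𝒜 b,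
          KernelRecovery.jacobianFrobNorm
            (KernelRecovery.kernelDeriv φ X₁ - KernelRecovery.kernelDeriv φ X₂)
              ≤ L * ‖X₁ - X₂‖) →
        KernelRecovery.PullbackLipschitzX r (KernelRecovery.kernelCost φ) 𝒜 b L) ∧
      (∀ L : ℝ,
        (∀ X₁ ∈ KernelRecovery.measurementSpace 𝒜 b, ∀ X₂ ∈ KernelRecovery.measurementSpace 𝒜 b,
          ∀ Z : Matrix (Fin n) (Fin s) ℝ,
            ‖KernelRecovery.kernelDeriv φ X₁ Z - KernelRecovery.kernelDeriv φ X₂ Z‖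
              ≤ L * ‖X₁ - X₂‖ * ‖Z‖) →
        KernelRecovery.PullbackLipschitzX r (KernelRecovery.kernelCost φ) 𝒜 b
          (Real.sqrt ((s : ℝ) - (r : ℝ)) * L))) ∧
    (∀ M : ℝ, (∀ X ∈ KernelRecovery.measurementSpace 𝒜 b,
        ‖KernelRecovery.kernelMatrix φ X‖ ≤ M) →
      KernelRecovery.PullbackLipschitzU r (KernelRecovery.kernelCost φ) 𝒜 b (2 * M)) := by
  refine ⟨fun hdiff => ⟨fun L hL => ?_, fun L hL => ?_⟩, fun M hM => ?_⟩
  · exact KernelRecovery.pullbackLipschitzX_kernelCost_of_jacobianFrobNorm_le hdiff hL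
  · exact KernelRecovery.pullbackLipschitzX_kernelCost_of_norm_kernelDeriv_sub_le hdiff hL
  · exact KernelRecovery.pullbackLipschitzU_kernelCost hM
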